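/- Conventions. A Lipschitz seminorm on a unital $C^*$-algebra $A$ is a seminorm $L:A\to[0,\infty]$ (so $L(a+b)\le L(a)+L(b)$ and $L(ca)=|c|L(a)$, with $0\cdot\infty=0$) such that $L(a^*)=L(a)$ for all $a$, $L(a)=0$ if and only if $a\in\mathbb{C}\mathbf 1_A$, and $\mathrm{dom}(L)=\{a:L(a)<\infty\}$ is dense in $A$. It is a Lip-norm if the Monge–Kantorovich metric $$\rho_L(\mu,\nu)=\sup\{|\mu(a)-\nu(a)|:a\in A,\ L(a)\le 1\}$$ on the state space $\mathcal S(A)$ induces the weak$^*$-topology; then $(A,L)$ is called a compact quantum metric space. An inductive sequence of compact quantum metric spaces $\{((A_n,L_n),\phi_n)\}_{n\ge 1}$ consists of compact quantum metric spaces $(A_n,L_n)$ and unital $^*$-homomorphisms $\phi_n:A_n\to A_{n+1}$ with $\phi_n(\mathrm{dom}(L_n))\subset\mathrm{dom}(L_{n+1})$. Let $A=\varinjlim(A_n,\phi_n)$ be the $C^*$-algebraic inductive limit, with canonical unital $^*$-homomorphisms $\phi^n:A_n\to A$. For $\mu,\nu\in\mathcal S(A)$ put $$\rho(\mu,\nu)=\sum_{n=1}^\infty\frac1{2^n}\,\frac{\rho_{L_n}(\mu\circ\phi^n,\nu\circ\phi^n)}{1+\rho_{L_n}(\mu\circ\phi^n,\nu\circ\phi^n)},$$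 and for $a\in A$ put $$L(a)=\sup\Big\{\frac{|\mu(a)-\nu(a)|}{\rho(\mu,\nu)}:\mu,\nu\in\mathcal S(A),\ \mu\ne\nu\Big\}\in[0,\infty].$$ **Proposition.** Let $\{((A_n,L_n),\phi_n)\}$ be an inductive sequence of compact quantum metric spaces, with $A$ and $L$ as above. Let $(B,L_B)$ be a compact quantum metric space whose Lip-norm $L_B$ is lower semicontinuous. Suppose that for each $n$ there are a real number $\lambda_n>0$ and a unital $^*$-homomorphism $\psi_n:A_n\to B$ such that $\psi_{n+1}\circ\phi_n=\psi_n$ and $$L_B(\psi_n(a))\le\lambda_nL_n(a)\quad\text{for all }a\in A_n.$$ If the sequence $\{\lambda_n\}$ is bounded, then there is a unique unital $^*$-homomorphism $\psi:A\to B$ with $\psi\circ\phi^n=\psi_n$ for every $n$, and it satisfies $$L_B(\psi(a))\le 2\,\sup_n\lambda_n\cdot L(a)\quad\text{for all }a\in A.$$ -/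

import Mathlib

namespace QuantumMetric

noncomputable section

open Filter Topology
open scoped ENNReal ComplexOrder

universe u v

/-! ### Inductive limits of sequences of unital C*-algebras -/

section InductiveLimit

variable {A : ℕ → Type u} [∀ n, CStarAlgebra (A n)]

/-- The unital `*`-algebra (with pointwise operations) of sequences `x` with `x n ∈ A n` that are
eventually coherent: `x (n + 1) = φ n (x n)` for all sufficiently large `n`. -/
def coherent (φ : ∀ n, A n →⋆ₐ[ℂ] A (n + 1)) : StarSubalgebra ℂ (∀ n, A n) where
  carrier := {x | ∀ᶠ n in atTop, φ n (x n) = x (n + 1)}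
  mul_mem' hx hy := by filter_upwards [hx, hy] with n h1 h2; simp [h1, h2]
  one_mem' := by simp
  add_mem' hx hy := by filter_upwards [hx, hy] with n h1 h2; simp [h1, h2]
  zero_mem' := by simp
  algebraMap_mem' r := by
    refine Eventually.of_forall fun n => ?_
    simp only [Pi.algebraMap_apply]
    exact AlgHomClass.commutes (φ n) r
  star_mem' hx := by filter_upwards [hx] with n h1; simp [map_star, h1]

/-- The algebra of eventually coherent sequences as a type of its own; it carries the C*-seminorm
`lim ‖x n‖` and no other topology. -/
def PreLimit (φ : ∀ n, A n →⋆ₐ[ℂ] A (n + 1)) : Type u := coherent φ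

variable (φ : ∀ n, A n →⋆ₐ[ℂ] A (n + 1))

instance : Ring (PreLimit φ) := inferInstanceAs (Ring (coherent φ))
instance : StarRing (PreLimit φ) := inferInstanceAs (StarRing (coherent φ))
instance : Algebra ℂ (PreLimit φ) := inferInstanceAs (Algebra ℂ (coherent φ))
instance : StarModule ℂ (PreLimit φ) := inferInstanceAs (StarModule ℂ (coherent φ))

namespace PreLimit

variable {φ}

/-- The `n`-th entry of an eventually coherent sequence. -/
def coord (n : ℕ) (x : PreLimit φ) : A n := x.1 n

theorem coord_succ (x : PreLimit φ) : ∀ᶠ n in atTop, φ n (x.coord n) = x.coord (n + 1) := x.2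

@[simp] theorem coord_add (n : ℕ) (x y : PreLimit φ) :
    (x + y).coord n = x.coord n + y.coord n := rfl
@[simp] theorem coord_mul (n : ℕ) (x y : PreLimit φ) :
    (x * y).coord n = x.coord n * y.coord n := rfl
@[simp] theorem coord_neg (n : ℕ) (x : PreLimit φ) : (-x).coord n = -x.coord n := rfl
@[simp] theorem coord_sub (n : ℕ) (x y : PreLimit φ) :
    (x - y).coord n = x.coord n - y.coord n := rfl
@[simp] theorem coord_zero (n : ℕ) : (0 : PreLimit φ).coord n = 0 := rfl
@[simp] theorem coord_one (n : ℕ) : (1 : PreLimit φ).coord n = 1 := rfl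
@[simp] theorem coord_smul (n : ℕ) (c : ℂ) (x : PreLimit φ) :
    (c • x).coord n = c • x.coord n := rfl
@[simp] theorem coord_star (n : ℕ) (x : PreLimit φ) : (star x).coord n = star (x.coord n) := rfl

/-- The seminorm `‖x‖ = lim ‖x n‖`. -/
instance : Norm (PreLimit φ) := ⟨fun x => limUnder atTop fun n => ‖x.coord n‖⟩

theorem tendsto_norm (x : PreLimit φ) :
    Tendsto (fun n => ‖x.coord n‖) atTop (𝓝 ‖x‖) := by
  refine tendsto_nhds_limUnder ?_
  obtain ⟨N, hN⟩ := eventually_atTop.1 x.coord_succ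
  have hanti : Antitone fun k => ‖x.coord (k + N)‖ := by
    refine antitone_nat_of_succ_le fun k => ?_
    have h := hN (k + N) (Nat.le_add_left _ _)
    have h2 : ‖x.coord (k + N + 1)‖ ≤ ‖x.coord (k + N)‖ := by
      rw [← h]; exact NonUnitalStarAlgHom.norm_apply_le (φ (k + N)) _
    have e : k + 1 + N = k + N + 1 := by omega
    rw [e]; exact h2
  have hb : BddBelow (Set.range fun k => ‖x.coord (k + N)‖) :=
    ⟨0, by rintro _ ⟨k, rfl⟩; exact norm_nonneg _⟩
  exact ⟨_, (tendsto_add_atTop_iff_nat (f := fun n => ‖x.coord n‖) N).1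
    (tendsto_atTop_ciInf hanti hb)⟩

theorem norm_zero' : ‖(0 : PreLimit φ)‖ = 0 :=
  tendsto_nhds_unique (tendsto_norm 0) (by simp)

theorem norm_add_le' (x y : PreLimit φ) : ‖x + y‖ ≤ ‖x‖ + ‖y‖ :=
  le_of_tendsto_of_tendsto' (tendsto_norm _) ((tendsto_norm x).add (tendsto_norm y))
    fun n => by simpa using norm_add_le (x.coord n) (y.coord n)

theorem norm_neg' (x : PreLimit φ) : ‖-x‖ = ‖x‖ :=
  tendsto_nhds_unique (tendsto_norm _) (by simpa using tendsto_norm x)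

/-- The coherent sequences form a seminormed ring. -/
instance : SeminormedRing (PreLimit φ) where
  __ : Ring (PreLimit φ) := inferInstance
  __ : SeminormedAddCommGroup (PreLimit φ) :=
    AddGroupSeminorm.toSeminormedAddCommGroup
      { toFun := fun x : PreLimit φ => ‖x‖
        map_zero' := norm_zero'
        add_le' := norm_add_le'
        neg' := norm_neg' }
  norm_mul_le x y :=
    le_of_tendsto_of_tendsto' (tendsto_norm (x * y)) ((tendsto_norm x).mul (tendsto_norm y))
      fun n => by simpa using norm_mul_le (x.coord n) (y.coord n)

theorem norm_star' (x : PreLimit φ) : ‖star x‖ = ‖x‖ :=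
  tendsto_nhds_unique (tendsto_norm _) (by simpa using tendsto_norm x)

theorem norm_star_mul_self' (x : PreLimit φ) : ‖star x * x‖ = ‖x‖ * ‖x‖ :=
  tendsto_nhds_unique (tendsto_norm _)
    (by simpa [CStarRing.norm_star_mul_self] using (tendsto_norm x).mul (tendsto_norm x))

instance : NormedAlgebra ℂ (PreLimit φ) where
  norm_smul_le c x :=
    le_of_tendsto_of_tendsto' (tendsto_norm (c • x)) ((tendsto_norm x).const_mul ‖c‖)
      fun n => by simpa using norm_smul_le c (x.coord n)

instance : NormedStarGroup (PreLimit φ) where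
  norm_star_le x := (norm_star' x).le

end PreLimit

/-- The C*-inductive limit: the Hausdorff completion of the `*`-algebra of eventually coherent
sequences with respect to the C*-seminorm `lim ‖x n‖`. -/
def InductiveLimit : Type u := UniformSpace.Completion (PreLimit φ)

namespace InductiveLimit

open UniformSpace

instance : NormedRing (InductiveLimit φ) :=
  inferInstanceAs (NormedRing (Completion (PreLimit φ)))

instance : CompleteSpace (InductiveLimit φ) :=
  inferInstanceAs (CompleteSpace (Completion (PreLimit φ)))

/-- The class of an eventually coherent sequence in the inductive limit. -/
def mk (x : PreLimit φ) : InductiveLimit φ := (x : Completion (PreLimit φ))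

variable {φ}

theorem continuous_mk : Continuous (mk φ) := Completion.continuous_coe _
theorem denseRange_mk : DenseRange (mk φ) := Completion.denseRange_coe
theorem norm_mk (x : PreLimit φ) : ‖mk φ x‖ = ‖x‖ := Completion.norm_coe x
theorem mk_add (x y : PreLimit φ) : mk φ (x + y) = mk φ x + mk φ y := Completion.coe_add x y
theorem mk_sub (x y : PreLimit φ) : mk φ (x - y) = mk φ x - mk φ y := Completion.coe_sub x y
theorem mk_mul (x y : PreLimit φ) : mk φ (x * y) = mk φ x * mk φ y := Completion.coe_mul x y
theorem mk_one : mk φ 1 = 1 := Completion.coe_one _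
theorem mk_zero : mk φ 0 = 0 := Completion.coe_zero

instance : Algebra ℂ (InductiveLimit φ) :=
  inferInstanceAs (Algebra ℂ (Completion (PreLimit φ)))

theorem mk_smul (c : ℂ) (x : PreLimit φ) : mk φ (c • x) = c • mk φ x := Completion.coe_smul c x

instance : NormedAlgebra ℂ (InductiveLimit φ) where
  norm_smul_le c x := norm_smul_le (β := Completion (PreLimit φ)) c x

/-- The involution of the inductive limit, the continuous extension of the entrywise one. -/
instance : Star (InductiveLimit φ) :=
  ⟨Completion.map (star : PreLimit φ → PreLimit φ)⟩

theorem continuous_star' : Continuous (star : InductiveLimit φ → InductiveLimit φ) :=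
  Completion.continuous_map

theorem mk_star (x : PreLimit φ) : mk φ (star x) = star (mk φ x) :=
  (Completion.map_coe (AddMonoidHomClass.uniformContinuous_of_bound (starAddEquiv (R := PreLimit φ)) 1 fun x => by simp) x).symm

theorem eq_of_mk {f g : InductiveLimit φ → InductiveLimit φ} (hf : Continuous f)
    (hg : Continuous g) (h : ∀ x, f (mk φ x) = g (mk φ x)) (a : InductiveLimit φ) : f a = g a :=
  congrFun (denseRange_mk.equalizer hf hg (funext h)) a

theorem norm_star_mul_self' (a : InductiveLimit φ) : ‖star a * a‖ = ‖a‖ * ‖a‖ := by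
  have h : (fun a : InductiveLimit φ => ‖star a * a‖) = fun a => ‖a‖ * ‖a‖ :=
    denseRange_mk.equalizer (continuous_star'.mul continuous_id).norm
      (continuous_norm.mul continuous_norm) (funext fun x => by
        simp only [Function.comp_apply, ← mk_star, ← mk_mul, norm_mk,
          PreLimit.norm_star_mul_self'])
  exact congrFun h a

instance : StarRing (InductiveLimit φ) where
  star_involutive a := eq_of_mk (continuous_star'.comp continuous_star') continuous_id
    (fun x => by simp [← mk_star]) a
  star_mul a b := by
    have h : ∀ x : PreLimit φ, star (a * mk φ x) = star (mk φ x) * star a := fun x =>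
      eq_of_mk (f := fun a => star (a * mk φ x)) (g := fun a => star (mk φ x) * star a)
        (continuous_star'.comp (continuous_id.mul continuous_const))
        (continuous_const.mul continuous_star')
        (fun y => by simp only [← mk_star, ← mk_mul, star_mul]) a
    exact eq_of_mk (f := fun b => star (a * b)) (g := fun b => star b * star a)
      (continuous_star'.comp (continuous_const.mul continuous_id))
      (continuous_star'.mul continuous_const) h b
  star_add a b := by
    have h : ∀ x : PreLimit φ, star (a + mk φ x) = star a + star (mk φ x) := fun x =>
      eq_of_mk (f := fun a => star (a + mk φ x)) (g := fun a => star a + star (mk φ x))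
        (continuous_star'.comp (continuous_id.add continuous_const))
        (continuous_star'.add continuous_const)
        (fun y => by simp only [← mk_star, ← mk_add, star_add]) a
    exact eq_of_mk (f := fun b => star (a + b)) (g := fun b => star a + star b)
      (continuous_star'.comp (continuous_const.add continuous_id))
      (continuous_const.add continuous_star') h b

/-- The inductive limit is a unital C*-algebra. -/
instance : CStarAlgebra (InductiveLimit φ) where
  norm_mul_self_le a := (norm_star_mul_self' a).ge
  star_smul c a := eq_of_mk (f := fun a => star (c • a)) (g := fun a => star c • star a)
    (continuous_star'.comp (continuous_const_smul c)) (continuous_star'.const_smul (star c))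
    (fun x => by simp only [← mk_star, ← mk_smul, star_smul]) a

end InductiveLimit

/-- The composite connecting map `A n → A m` for `n ≤ m`. -/
def connecting {n m : ℕ} (h : n ≤ m) : A n →⋆ₐ[ℂ] A m :=
  Nat.leRec (motive := fun m _ => A n →⋆ₐ[ℂ] A m) (StarAlgHom.id ℂ (A n))
    (fun k _ f => (φ k).comp f) h

theorem connecting_self (n : ℕ) : connecting φ (le_refl n) = StarAlgHom.id ℂ (A n) :=
  Nat.leRec_self _ _

theorem connecting_succ {n m : ℕ} (h : n ≤ m) (h' : n ≤ m + 1) :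
    connecting φ h' = (φ m).comp (connecting φ h) :=
  Nat.leRec_succ _ _ h

open Classical in
/-- The sequence `(0, …, 0, a, φ n a, φ (n + 1) (φ n a), …)` with `a` in place `n`. -/
def PreLimit.tail (n : ℕ) (a : A n) : PreLimit φ :=
  ⟨fun m => if h : n ≤ m then connecting φ h a else 0, by
    refine (eventually_ge_atTop n).mono fun m hm => ?_
    simp only [dif_pos hm, dif_pos (Nat.le_succ_of_le hm)]
    rw [connecting_succ φ hm (Nat.le_succ_of_le hm)]; rfl⟩

theorem PreLimit.tail_coord {n m : ℕ} (h : n ≤ m) (a : A n) :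
    (PreLimit.tail φ n a).coord m = connecting φ h a := dif_pos h

theorem InductiveLimit.mk_eq {x y : PreLimit φ} (h : ∀ᶠ n in atTop, x.coord n = y.coord n) :
    InductiveLimit.mk φ x = InductiveLimit.mk φ y := by
  rw [← sub_eq_zero, ← InductiveLimit.mk_sub, ← norm_eq_zero, InductiveLimit.norm_mk]
  refine tendsto_nhds_unique (PreLimit.tendsto_norm (x - y)) (tendsto_const_nhds.congr' ?_)
  filter_upwards [h] with n hn
  simp [hn]

/-- The canonical unital `*`-homomorphism from `A n` to the inductive limit. -/
def InductiveLimit.of (n : ℕ) : A n →⋆ₐ[ℂ] InductiveLimit φ where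
  toFun a := InductiveLimit.mk φ (PreLimit.tail φ n a)
  map_one' := by
    rw [← InductiveLimit.mk_one]
    refine InductiveLimit.mk_eq φ ((eventually_ge_atTop n).mono fun m hm => ?_)
    simp [PreLimit.tail_coord φ hm]
  map_mul' a b := by
    rw [← InductiveLimit.mk_mul]
    refine InductiveLimit.mk_eq φ ((eventually_ge_atTop n).mono fun m hm => ?_)
    simp [PreLimit.tail_coord φ hm]
  map_zero' := by
    rw [← InductiveLimit.mk_zero]
    refine InductiveLimit.mk_eq φ ((eventually_ge_atTop n).mono fun m hm => ?_)
    simp [PreLimit.tail_coord φ hm]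
  map_add' a b := by
    rw [← InductiveLimit.mk_add]
    refine InductiveLimit.mk_eq φ ((eventually_ge_atTop n).mono fun m hm => ?_)
    simp [PreLimit.tail_coord φ hm]
  commutes' c := by
    rw [Algebra.algebraMap_eq_smul_one, Algebra.algebraMap_eq_smul_one, ← InductiveLimit.mk_one,
      ← InductiveLimit.mk_smul]
    refine InductiveLimit.mk_eq φ ((eventually_ge_atTop n).mono fun m hm => ?_)
    simp [PreLimit.tail_coord φ hm]
  map_star' a := by
    rw [← InductiveLimit.mk_star]
    refine InductiveLimit.mk_eq φ ((eventually_ge_atTop n).mono fun m hm => ?_)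
    simp [PreLimit.tail_coord φ hm, map_star]

theorem connecting_comp {n m : ℕ} (h : n + 1 ≤ m) (h' : n ≤ m) :
    (connecting φ h).comp (φ n) = connecting φ h' := by
  induction m, h using Nat.le_induction with
  | base => rw [connecting_self, connecting_succ φ (le_refl n), connecting_self]; rfl
  | succ m h ih =>
    rw [connecting_succ φ h, connecting_succ φ (Nat.le_of_succ_le h), ← ih (Nat.le_of_succ_le h)]
    rfl

theorem InductiveLimit.of_comp (n : ℕ) :
    (InductiveLimit.of φ (n + 1)).comp (φ n) = InductiveLimit.of φ n := by
  refine StarAlgHom.ext fun a => InductiveLimit.mk_eq φ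
    ((eventually_ge_atTop (n + 1)).mono fun m hm => ?_)
  rw [PreLimit.tail_coord φ hm, PreLimit.tail_coord φ (Nat.le_of_succ_le hm),
    ← connecting_comp φ hm]
  rfl

theorem InductiveLimit.dense_iUnion_range_of :
    Dense (⋃ n, Set.range (InductiveLimit.of φ n)) := by
  refine InductiveLimit.denseRange_mk.mono ?_
  rintro _ ⟨x, rfl⟩
  obtain ⟨N, hN⟩ := eventually_atTop.1 x.coord_succ
  refine Set.mem_iUnion.2 ⟨N, x.coord N, InductiveLimit.mk_eq φ ?_⟩
  refine (eventually_ge_atTop N).mono fun m hm => ?_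
  rw [PreLimit.tail_coord φ hm]
  induction m, hm using Nat.le_induction with
  | base => rw [connecting_self]; rfl
  | succ m h ih => rw [connecting_succ φ h, ← hN m h, ← ih]; rfl

end InductiveLimit

/-! ### States, Lip-norms and the Monge-Kantorovich metric -/

section Lip

variable {A : Type u} [CStarAlgebra A]

/-- The state space of a unital C*-algebra, with the weak* topology: the positive continuous
linear functionals `μ` with `μ 1 = 1`. -/
def StateSpace (A : Type u) [CStarAlgebra A] : Set (WeakDual ℂ A) :=
  {μ | (∀ a : A, 0 ≤ μ (star a * a)) ∧ μ 1 = 1}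

/-- The pull-back `μ ∘ f` of a state along a unital `*`-homomorphism. -/
def StateSpace.pullback {B : Type v} [CStarAlgebra B] (f : A →⋆ₐ[ℂ] B) (μ : StateSpace B) :
    StateSpace A :=
  ⟨StrongDual.toWeakDual ((WeakDual.toStrongDual μ.1).comp
      (⟨f.toAlgHom.toLinearMap, AddMonoidHomClass.continuous_of_bound f 1 fun a => by
        simpa using NonUnitalStarAlgHom.norm_apply_le f a⟩ : A →L[ℂ] B)), by
    refine ⟨fun a => ?_, ?_⟩
    · change 0 ≤ μ.1 (f (star a * a))
      rw [map_mul, map_star]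
      exact μ.2.1 (f a)
    · change μ.1 (f 1) = 1
      rw [map_one]
      exact μ.2.2⟩

@[simp] theorem StateSpace.pullback_apply {B : Type v} [CStarAlgebra B] (f : A →⋆ₐ[ℂ] B)
    (μ : StateSpace B) (a : A) : (StateSpace.pullback f μ).1 a = μ.1 (f a) := rfl

/-- Lipschitz seminorms: `*`-invariant seminorms with values in `[0, ∞]` that vanish exactly on
the scalars and are finite on a dense set. -/
structure IsLipschitzSeminorm (L : A → ℝ≥0∞) : Prop where
  add_le : ∀ a b, L (a + b) ≤ L a + L b
  smul : ∀ (c : ℂ) (a : A), L (c • a) = ‖c‖ₑ * L a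
  star : ∀ a, L (star a) = L a
  eq_zero_iff : ∀ a, L a = 0 ↔ ∃ c : ℂ, a = c • (1 : A)
  dense : Dense {a | L a < ∞}

/-- The Monge-Kantorovich metric `ρ_L(μ, ν) = sup {|μ(a) - ν(a)| : L(a) ≤ 1}` on the state space,
with values in `[0, ∞]`. -/
@[reducible] def mongeKantorovich (L : A → ℝ≥0∞) : PseudoEMetricSpace (StateSpace A) where
  edist μ ν := ⨆ (a : A) (_ : L a ≤ 1), ‖μ.1 a - ν.1 a‖ₑ
  edist_self μ := by simp
  edist_comm μ ν := by simp only [← enorm_neg (μ.1 _ - ν.1 _), neg_sub]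
  edist_triangle μ ν κ := by
    refine iSup₂_le fun a ha => ?_
    calc ‖μ.1 a - κ.1 a‖ₑ = ‖(μ.1 a - ν.1 a) + (ν.1 a - κ.1 a)‖ₑ := by rw [sub_add_sub_cancel]
      _ ≤ ‖μ.1 a - ν.1 a‖ₑ + ‖ν.1 a - κ.1 a‖ₑ := enorm_add_le _ _
      _ ≤ _ := add_le_add (le_iSup₂_of_le a ha le_rfl) (le_iSup₂_of_le a ha le_rfl)

/-- The Monge-Kantorovich distance of two states. -/
def mkDist (L : A → ℝ≥0∞) (μ ν : StateSpace A) : ℝ≥0∞ := (mongeKantorovich L).edist μ ν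

/-- Lip-norms: Lipschitz seminorms whose Monge-Kantorovich metric induces the weak* topology on
the state space. A compact quantum metric space is a unital C*-algebra with a Lip-norm. -/
structure IsLipNorm (L : A → ℝ≥0∞) : Prop extends IsLipschitzSeminorm L where
  topology_eq : (mongeKantorovich L).toUniformSpace.toTopologicalSpace =
    (instTopologicalSpaceSubtype : TopologicalSpace (StateSpace A))

end Lip

/-! ### The Lip-norm of an inductive limit of compact quantum metric spaces -/

section LimitLip

variable {A : ℕ → Type u} [∀ n, CStarAlgebra (A n)]

/-- Inductive sequences of compact quantum metric spaces: every `(A n, L n)` is a compact quantum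
metric space and the connecting unital `*`-homomorphisms preserve Lipschitz elements. -/
structure IsInductiveSequence (L : ∀ n, A n → ℝ≥0∞) (φ : ∀ n, A n →⋆ₐ[ℂ] A (n + 1)) : Prop where
  isLipNorm : ∀ n, IsLipNorm (L n)
  map_dom : ∀ n a, L n a < ∞ → L (n + 1) (φ n a) < ∞

/-- The distance `ρ_n(μ_n, ν_n)` of the restrictions `μ_n = μ ∘ φⁿ` and `ν_n = ν ∘ φⁿ` of two
states of the inductive limit to the `n`-th algebra of the sequence. -/
def restrictDist (L : ∀ n, A n → ℝ≥0∞) (φ : ∀ n, A n →⋆ₐ[ℂ] A (n + 1)) (n : ℕ)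
    (μ ν : StateSpace (InductiveLimit φ)) : ℝ≥0∞ :=
  mkDist (L n) (StateSpace.pullback (InductiveLimit.of φ n) μ)
    (StateSpace.pullback (InductiveLimit.of φ n) ν)

/-- The metric `ρ(μ, ν) = ∑ 2⁻ⁿ ρ_n(μ_n, ν_n) / (1 + ρ_n(μ_n, ν_n))` on the state space of the
inductive limit. The sequence is indexed from `0` here, so that the weights are `2⁻¹, 2⁻², …`.
All the distances `ρ_n(μ_n, ν_n)` are finite if the `L n` are Lip-norms (the state space is
connected), so that the quotient `∞ / ∞` does not occur. -/
def limitDist (L : ∀ n, A n → ℝ≥0∞) (φ : ∀ n, A n →⋆ₐ[ℂ] A (n + 1))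
    (μ ν : StateSpace (InductiveLimit φ)) : ℝ≥0∞ :=
  ∑' n, 2⁻¹ ^ (n + 1) *
    (restrictDist L φ n μ ν / (1 + restrictDist L φ n μ ν))

/-- The Lip-norm `L(a) = sup {|μ(a) - ν(a)| / ρ(μ, ν) : μ ≠ ν}` on the inductive limit. -/
def limitLipNorm (L : ∀ n, A n → ℝ≥0∞) (φ : ∀ n, A n →⋆ₐ[ℂ] A (n + 1))
    (a : InductiveLimit φ) : ℝ≥0∞ :=
  ⨆ (μ : StateSpace (InductiveLimit φ)) (ν : StateSpace (InductiveLimit φ)) (_ : μ ≠ ν),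
    ‖μ.1 a - ν.1 a‖ₑ / limitDist L φ μ ν

end LimitLip

end

end QuantumMetric

/-! The map `Ψ` comes from the universal property of the limit: unital `*`-homomorphisms are
contractive, so a compatible family extends to the completion, and density of the images gives
uniqueness. For the estimate, pulling back states along `ψ n` is Lipschitz with constant `lam n`.
Since `t / (1 + t) ≤ t` and the weights sum to one, `ρ(μ ∘ Ψ, ν ∘ Ψ) ≤ sup λ · ρ_B(μ, ν)`. If `L(a)
< ∞`, then `|μ(Ψ a) - ν(Ψ a)| ≤ sup λ · L(a) · ρ_B(μ, ν)` for all states of `B`.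

It remains to recover `LB` from its metric (`le_two_mul_of_lipschitz`), an argument in the style of
Rieffel. If `b` is self-adjoint with `LB b > C`, lower semicontinuity keeps a ball around `b` off
`{LB ≤ C}`. Hahn-Banach then yields two positive functionals of equal mass; normalized, they are
states with `|μ(b) - ν(b)| > C ρ_B(μ, ν)` (`le_ofReal_of_lipschitz`). Splitting a general element
into real and imaginary parts costs the factor 2. -/

namespace QuantumMetric

open Filter Topology
open scoped ENNReal ComplexOrder ComplexStarModule

universe u v

/-! ### Separation by positive functionals, and states. -/

section Positive

variable {A : Type u} [CStarAlgebra A] [PartialOrder A] [StarOrderedRing A]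

/-- A self-adjoint element between `-r` and `r` has norm at most `r`. -/
theorem norm_le_of_le_algebraMap {a : A} (ha : IsSelfAdjoint a) {r : ℝ} (hr : 0 ≤ r)
    (h1 : a ≤ algebraMap ℝ A r) (h2 : -a ≤ algebraMap ℝ A r) : ‖a‖ ≤ r := by
  rcases subsingleton_or_nontrivial A with _ | _
  · simpa [Subsingleton.elim a 0] using hr
  rcases CStarAlgebra.norm_or_neg_norm_mem_spectrum ha with h | h
  · exact (le_algebraMap_iff_spectrum_le (ha := ha)).1 h1 _ h
  · refine (le_algebraMap_iff_spectrum_le (ha := ha.neg)).1 h2 _ ?_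
    rw [← spectrum.neg_eq]
    simpa using h

/-- A convex set whose real parts stay at distance `ε` from the scalars is strictly separated from
`0` by a difference of two positive functionals. -/
theorem exists_positive_separation {K : Set A} (hK : Convex ℝ K) {ε : ℝ} (hε : 0 < ε)
    (h : ∀ x ∈ K, ∀ s : ℝ, ε ≤ ‖(ℜ x : A) - algebraMap ℝ A s‖) :
    ∃ (F G : A →L[ℝ] ℝ) (u : ℝ), 0 < u ∧ (∀ y, (ℜ y : A) ≤ 0 → F y ≤ 0) ∧
      (∀ y, (ℜ y : A) ≤ 0 → G y ≤ 0) ∧ ∀ x ∈ K, u ≤ F x - G x := by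
  -- The pair `(x, -x)` lies in `P` exactly when some scalar `s` and some `r < ε` satisfy `-r ≤ ℜ x
  -- - s ≤ r`. Working in `A × A` makes the separating functional split into two positive ones.
  let P : Set (A × A) := {p | ∃ s r : ℝ, 0 ≤ r ∧ r < ε ∧
    (ℜ p.1 : A) ≤ algebraMap ℝ A (r + s) ∧ (ℜ p.2 : A) ≤ algebraMap ℝ A (r - s)}
  have hPc : Convex ℝ P := by
    rintro p ⟨s, r, hr0, hr, h1, h2⟩ q ⟨s', r', hr0', hr', h1', h2'⟩ a b ha hb hab
    refine ⟨a * s + b * s', a * r + b * r', by positivity, ?_, ?_, ?_⟩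
    · calc a * r + b * r' < a * ε + b * ε := by
            rcases ha.eq_or_lt with rfl | ha
            · have : b = 1 := by linarith
              subst this; linarith
            · have := mul_lt_mul_of_pos_left hr ha
              have := mul_le_mul_of_nonneg_left hr'.le hb
              linarith
        _ = ε := by rw [← add_mul, hab, one_mul]
    · have := add_le_add (smul_le_smul_of_nonneg_left h1 ha) (smul_le_smul_of_nonneg_left h1' hb)
      convert this using 1
      · simp
      · simp only [Algebra.algebraMap_eq_smul_one, smul_smul, ← add_smul]
        congr 1; ring
    · have := add_le_add (smul_le_smul_of_nonneg_left h2 ha) (smul_le_smul_of_nonneg_left h2' hb)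
      convert this using 1
      · simp
      · simp only [Algebra.algebraMap_eq_smul_one, smul_smul, ← add_smul]
        congr 1; ring
  -- A norm perturbation of size `η` raises an upper bound on the real part by at most `η`; the
  -- slack `ε - r` thus makes `P` open.
  have hre (x y : A) {η c : ℝ} (hxy : ‖y - x‖ < η) (hx : (ℜ x : A) ≤ algebraMap ℝ A c) :
      (ℜ y : A) ≤ algebraMap ℝ A (c + η) := by
    have h1 : (ℜ (y - x) : A) ≤ algebraMap ℝ A ‖(ℜ (y - x) : A)‖ :=
      (ℜ (y - x)).2.le_algebraMap_norm_self
    have h2 : ‖(ℜ (y - x) : A)‖ ≤ η := (realPart.norm_le (y - x)).trans hxy.le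
    have h3 := add_le_add hx (h1.trans (algebraMap_mono A h2))
    rw [← map_add] at h3
    simpa using h3
  have hPo : IsOpen P := by
    rw [Metric.isOpen_iff]
    rintro p ⟨s, r, hr0, hr, h1, h2⟩
    refine ⟨(ε - r) / 2, by linarith, fun q hq => ⟨s, r + (ε - r) / 2, by linarith, by linarith,
      ?_, ?_⟩⟩
    · have := hre p.1 q.1 (η := (ε - r) / 2) ?_ h1
      · convert this using 2; ring
      · rw [← dist_eq_norm]
        exact (le_max_left _ _).trans_lt hq
    · have := hre p.2 q.2 (η := (ε - r) / 2) ?_ h2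
      · convert this using 2; ring
      · rw [← dist_eq_norm]
        exact (le_max_right _ _).trans_lt hq
  let ι : A →ₗ[ℝ] A × A := LinearMap.prod LinearMap.id (-LinearMap.id)
  have hdisj : Disjoint P (ι '' K) := by
    rw [Set.disjoint_left]
    rintro _ ⟨s, r, hr0, hr, h1, h2⟩ ⟨x, hx, rfl⟩
    refine absurd (h x hx s) (not_le.2 (lt_of_le_of_lt ?_ hr))
    refine norm_le_of_le_algebraMap ((ℜ x).2.sub (IsSelfAdjoint.algebraMap A (.all s))) hr0 ?_ ?_
    · simpa [ι, sub_le_iff_le_add] using h1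
    · have : -(ℜ x : A) ≤ algebraMap ℝ A (r - s) := by simpa [ι] using h2
      rw [map_sub] at this
      rw [neg_sub, sub_eq_add_neg, add_comm]
      exact le_sub_iff_add_le.1 this
  obtain ⟨f, u, hf, hfu⟩ := geometric_hahn_banach_open hPc hPo (hK.linear_image ι) hdisj
  have h0 : ((0 : A), (0 : A)) ∈ P := ⟨0, 0, le_rfl, hε, by simp, by simp⟩
  have hu : 0 < u := by simpa [← Prod.zero_eq_mk] using hf _ h0
  -- `P` contains every ray `(n • y, 0)` and `(0, n • y)` with `ℜ y ≤ 0`; boundedness above along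
  -- the ray forces a nonpositive slope.
  have hcone {t : ℝ} (H : ∀ n : ℕ, n * t < u) : t ≤ 0 := by
    by_contra ht
    obtain ⟨n, hn⟩ := exists_nat_gt (u / t)
    exact (H n).not_gt ((div_lt_iff₀ (not_le.1 ht)).1 hn)
  refine ⟨f.comp (ContinuousLinearMap.inl ℝ A A), f.comp (ContinuousLinearMap.inr ℝ A A), u, hu,
    fun y hy => hcone fun n => ?_, fun y hy => hcone fun n => ?_, fun x hx => ?_⟩
  · have hP : ((n : ℝ) • y, (0 : A)) ∈ P :=
      ⟨0, 0, le_rfl, hε, by simpa using smul_nonpos_of_nonneg_of_nonpos n.cast_nonneg hy, by simp⟩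
    have e : ((n : ℝ) • y, (0 : A)) = (n : ℝ) • (y, (0 : A)) := by simp
    have := hf _ hP
    rw [e, map_smul] at this
    exact this
  · have hP : ((0 : A), (n : ℝ) • y) ∈ P :=
      ⟨0, 0, le_rfl, hε, by simp, by simpa using smul_nonpos_of_nonneg_of_nonpos n.cast_nonneg hy⟩
    have e : ((0 : A), (n : ℝ) • y) = (n : ℝ) • ((0 : A), y) := by simp
    have := hf _ hP
    rw [e, map_smul] at this
    exact this
  · have := hfu _ ⟨x, hx, rfl⟩
    have e : ι x = (x, 0) - (0, x) := by simp [ι]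
    rw [e, map_sub] at this
    simpa using this

/-- A positive real functional that does not vanish at `1` is, up to normalization, the real part
of a state. -/
theorem exists_state_of_positive (F : A →L[ℝ] ℝ) (hF : ∀ y, (ℜ y : A) ≤ 0 → F y ≤ 0)
    (h1 : 0 < F 1) : ∃ μ : StateSpace A, ∀ y, F 1 * (μ.1 y).re = F y := by
  -- Both `y` and `-y` have real part `≤ 0`. So `F` kills skew-adjoint elements, and its
  -- complexification is real on self-adjoint ones.
  have hskew (y : A) (hy : ℜ y = 0) : F y = 0 := by
    refine le_antisymm (hF y (by simp [hy])) ?_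
    simpa using hF (-y) (by simp [hy])
  have hI (y : A) (hy : IsSelfAdjoint y) : F (Complex.I • y) = 0 :=
    hskew _ (by rw [realPart_I_smul, hy.imaginaryPart, neg_zero])
  let g : A →L[ℂ] ℂ := StrongDual.extendRCLike F
  have hg (y : A) : g y = F y - Complex.I * F (Complex.I • y) :=
    StrongDual.extendRCLike_apply (𝕜 := ℂ) F y
  refine ⟨⟨StrongDual.toWeakDual (((F 1 : ℂ)⁻¹) • g), fun a => ?_, ?_⟩, fun y => ?_⟩
  · change 0 ≤ (F 1 : ℂ)⁻¹ * g (star a * a)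
    rw [hg, hI _ (.star_mul_self a), ← Complex.ofReal_inv, Complex.ofReal_zero, mul_zero, sub_zero,
      ← Complex.ofReal_mul, Complex.zero_le_real]
    refine mul_nonneg (inv_nonneg.2 h1.le) ?_
    have := hF (-(star a * a)) (by
      rw [map_neg, NegMemClass.coe_neg, (IsSelfAdjoint.star_mul_self a).coe_realPart]
      simp [star_mul_self_nonneg a])
    simpa using this
  · change (F 1 : ℂ)⁻¹ * g 1 = 1
    rw [hg, hI _ (.one A)]
    simp [h1.ne']
  · change F 1 * ((F 1 : ℂ)⁻¹ * g y).re = F y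
    rw [← Complex.ofReal_inv, Complex.re_ofReal_mul, mul_inv_cancel_left₀ h1.ne', hg]
    simp

end Positive

/-! ### Recovering a seminorm from its Monge-Kantorovich metric. -/

section Rieffel

theorem enorm_ofReal (r : ℝ) : ‖(r : ℂ)‖ₑ = ‖r‖ₑ := by
  rw [← ofReal_norm, Complex.norm_real, ofReal_norm]

variable {A : Type u} [CStarAlgebra A] {L : A → ℝ≥0∞}

namespace IsLipschitzSeminorm

theorem smul_real (hL : IsLipschitzSeminorm L) (r : ℝ) (a : A) : L (r • a) = ‖r‖ₑ * L a := by
  rw [← Complex.coe_smul, hL.smul, enorm_ofReal]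

theorem neg (hL : IsLipschitzSeminorm L) (a : A) : L (-a) = L a := by
  simpa using hL.smul (-1) a

theorem add_algebraMap_le (hL : IsLipschitzSeminorm L) (a : A) (r : ℝ) :
    L (a + algebraMap ℝ A r) ≤ L a := by
  refine (hL.add_le _ _).trans ?_
  rw [(hL.eq_zero_iff (algebraMap ℝ A r)).2 ⟨r, by rw [Algebra.algebraMap_eq_smul_one,
    Complex.coe_smul]⟩, add_zero]

theorem half_le (hL : IsLipschitzSeminorm L) {a b : A} (h : L b = L a) :
    L ((2⁻¹ : ℝ) • (a + b)) ≤ L a := by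
  rw [hL.smul_real]
  calc ‖(2⁻¹ : ℝ)‖ₑ * L (a + b) ≤ 2⁻¹ * (L a + L a) := by
        gcongr
        · rw [Real.enorm_of_nonneg (by norm_num), ENNReal.ofReal_inv_of_pos two_pos]
          simp
        · exact (hL.add_le a b).trans (by rw [h])
    _ = L a := by rw [← two_mul, ← mul_assoc, ENNReal.inv_mul_cancel (by simp) (by simp), one_mul]

theorem realPart_le (hL : IsLipschitzSeminorm L) (a : A) : L (ℜ a : A) ≤ L a := by
  rw [realPart_apply_coe]
  exact hL.half_le (hL.star a)

end IsLipschitzSeminorm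

/-- Two states are within Monge-Kantorovich distance `d` as soon as their difference, up to a
phase, has real part at most `d` on all `a` with `L a ≤ 1`. -/
theorem mkDist_le_of_re_le (hL : IsLipschitzSeminorm L) {μ ν : StateSpace A} {d : ℝ}
    (h : ∀ a, L a ≤ 1 → (μ.1 a).re - (ν.1 a).re ≤ d) : mkDist L μ ν ≤ ENNReal.ofReal d := by
  refine iSup₂_le fun a ha => ?_
  obtain ⟨c, hc, hca⟩ : ∃ c : ℂ, ‖c‖ = 1 ∧ ‖μ.1 a - ν.1 a‖ = c * (μ.1 a - ν.1 a) :=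
    Complex.exists_norm_eq_mul_self (μ.1 a - ν.1 a)
  rw [← ofReal_norm]
  refine ENNReal.ofReal_le_ofReal ?_
  have h1 := h (c • a) (by
    rw [hL.smul, ← ofReal_norm, hc, ENNReal.ofReal_one, one_mul]; exact ha)
  rw [map_smul, map_smul, ← Complex.sub_re, ← smul_sub, smul_eq_mul, ← hca] at h1
  simpa using h1

/-- A lower semicontinuous Lipschitz seminorm is recovered on self-adjoint elements from its
Monge-Kantorovich metric. -/
theorem le_ofReal_of_lipschitz (hL : IsLipschitzSeminorm L) (hlsc : LowerSemicontinuous L)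
    {b : A} (hb : IsSelfAdjoint b) {C : ℝ} (hC : 0 < C)
    (h : ∀ μ ν : StateSpace A, ‖μ.1 b - ν.1 b‖ₑ ≤ ENNReal.ofReal C * mkDist L μ ν) :
    L b ≤ ENNReal.ofReal C := by
  -- Positivity enters only inside this proof, so the order is chosen here.
  let := CStarAlgebra.spectralOrder A
  have := CStarAlgebra.spectralOrderedRing A
  by_contra hbC
  obtain ⟨ε, hε, hball⟩ := Metric.isOpen_iff.1
    (hlsc.isClosed_preimage (ENNReal.ofReal C)).isOpen_compl b hbC
  -- `K` is `b` minus a sublevel set of `L`. A point of `K` with real part within `ε` of a scalar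
  -- would produce an element of the ball around `b` with `L ≤ C`.
  let K : Set A := {w | L (b - w) ≤ ENNReal.ofReal C}
  have hK : Convex ℝ K := by
    intro x hx y hy s t hs ht hst
    have e : b - (s • x + t • y) = s • (b - x) + t • (b - y) := by
      nth_rw 1 [← one_smul ℝ b, ← hst]
      module
    change L (b - (s • x + t • y)) ≤ _
    calc L (b - (s • x + t • y)) ≤ ‖s‖ₑ * L (b - x) + ‖t‖ₑ * L (b - y) := by
          rw [e, ← hL.smul_real, ← hL.smul_real]; exact hL.add_le _ _
      _ ≤ ‖s‖ₑ * ENNReal.ofReal C + ‖t‖ₑ * ENNReal.ofReal C := by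
          gcongr
          · exact hx
          · exact hy
      _ = ENNReal.ofReal C := by
          rw [← add_mul, Real.enorm_of_nonneg hs, Real.enorm_of_nonneg ht,
            ← ENNReal.ofReal_add hs ht, hst, ENNReal.ofReal_one, one_mul]
  have hdist : ∀ w ∈ K, ∀ s : ℝ, ε ≤ ‖(ℜ w : A) - algebraMap ℝ A s‖ := by
    intro w hw s
    by_contra hlt
    have e : (ℜ w : A) - algebraMap ℝ A s = b - ((ℜ (b - w) : A) + algebraMap ℝ A s) := by
      rw [map_sub, AddSubgroupClass.coe_sub, hb.coe_realPart]; abel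
    rw [e, not_le, ← dist_eq_norm, dist_comm] at hlt
    exact hball hlt (((hL.add_algebraMap_le _ s).trans (hL.realPart_le _)).trans hw)
  obtain ⟨F, G, u, hu, hF, hG, hK'⟩ := exists_positive_separation hK hε hdist
  have hshift (r : ℝ) : u ≤ (F b - G b) + r * (F 1 - G 1) := by
    have hm : b + r • (1 : A) ∈ K := by
      change L (b - (b + r • (1 : A))) ≤ _
      rw [sub_add_cancel_left, hL.neg, (hL.eq_zero_iff _).2 ⟨r, (Complex.coe_smul r _).symm⟩]
      exact zero_le
    have := hK' _ hm
    rw [map_add, map_add, map_smul, map_smul, smul_eq_mul, smul_eq_mul] at this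
    linarith
  -- An affine function of `r` bounded below by `u > 0` for all real `r` has slope zero.
  have heq : F 1 = G 1 := by
    by_contra hne
    have h1 := hshift (-(F b - G b) / (F 1 - G 1))
    rw [div_mul_cancel₀ _ (sub_ne_zero.2 hne)] at h1
    linarith
  have hmono {H : A →L[ℝ] ℝ} (hH : ∀ y, (ℜ y : A) ≤ 0 → H y ≤ 0) {y : A} {r : ℝ}
      (hy : (ℜ y : A) ≤ algebraMap ℝ A r) : H y ≤ r * H 1 := by
    have := hH (y - r • (1 : A)) (by
      rw [map_sub, AddSubgroupClass.coe_sub, map_smul, selfAdjoint.val_smul,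
        (IsSelfAdjoint.one A).coe_realPart, ← Algebra.algebraMap_eq_smul_one]
      exact sub_nonpos.2 hy)
    rw [map_sub, map_smul, smul_eq_mul] at this
    linarith
  -- Positivity gives `F b - G b ≤ 2 * ‖b‖ * F 1`, while the left side is at least `u > 0`.
  have hF1 : 0 < F 1 := by
    have h1 := hmono hF (y := b) (by
      rw [hb.coe_realPart]; exact hb.le_algebraMap_norm_self)
    have h2 := hmono hG (y := -b) (by
      rw [hb.neg.coe_realPart]; exact hb.neg.le_algebraMap_norm_self)
    have h3 := hshift 0
    rw [map_neg, norm_neg, ← heq] at h2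
    by_contra hle
    have := mul_nonpos_of_nonneg_of_nonpos (norm_nonneg b) (not_lt.1 hle)
    linarith
  obtain ⟨μ, hμ⟩ := exists_state_of_positive F hF hF1
  obtain ⟨ν, hν⟩ := exists_state_of_positive G hG (heq ▸ hF1)
  rw [← heq] at hν
  set D := (μ.1 b).re - (ν.1 b).re with hD
  -- Testing the separation on `b - C • a`, which lies in `K` when `L a ≤ 1`, puts `C` times the
  -- distance a definite amount `u / F 1` below `D`, against the Lipschitz hypothesis.
  have hbound : mkDist L μ ν ≤ ENNReal.ofReal ((D - u / F 1) / C) := by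
    refine mkDist_le_of_re_le hL fun a ha => ?_
    have hm : b - C • a ∈ K := by
      change L (b - (b - C • a)) ≤ _
      rw [sub_sub_cancel, hL.smul_real, Real.enorm_of_nonneg hC.le]
      exact mul_le_of_le_one_right' ha
    have h1 := hK' _ hm
    rw [map_sub, map_sub, map_smul, map_smul, ← hμ b, ← hμ a, ← hν b, ← hν a,
      smul_eq_mul, smul_eq_mul] at h1
    have h2 : u / F 1 ≤ D - C * ((μ.1 a).re - (ν.1 a).re) := by
      rw [div_le_iff₀ hF1, hD]; linarith
    rw [le_div_iff₀ hC]; linarith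
  have h1 : ENNReal.ofReal D ≤ ENNReal.ofReal (D - u / F 1) := by
    calc ENNReal.ofReal D ≤ ENNReal.ofReal ‖μ.1 b - ν.1 b‖ := by
          refine ENNReal.ofReal_le_ofReal ?_
          rw [hD, ← Complex.sub_re]
          exact Complex.re_le_norm _
      _ = ‖μ.1 b - ν.1 b‖ₑ := ofReal_norm _
      _ ≤ ENNReal.ofReal C * ENNReal.ofReal ((D - u / F 1) / C) := (h μ ν).trans (by gcongr)
      _ = ENNReal.ofReal (D - u / F 1) := by
          rw [← ENNReal.ofReal_mul hC.le, mul_div_cancel₀ _ hC.ne']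
  -- `ENNReal.ofReal` truncates at zero, so the final contradiction needs `D > 0`.
  have hDpos : 0 < D := by
    have h2 := hshift 0
    rw [← hμ b, ← hν b] at h2
    have h3 : 0 < F 1 * D := by rw [hD]; linarith
    exact pos_of_mul_pos_right h3 hF1.le
  have h2 : 0 < u / F 1 := div_pos hu hF1
  exact absurd h1 (not_le.2 ((ENNReal.ofReal_lt_ofReal_iff hDpos).2 (by linarith)))

/-- States are hermitian. -/
theorem state_star (μ : StateSpace A) (a : A) : μ.1 (star a) = star (μ.1 a) := by
  -- Polarization: `μ` is real on squares, so the cross terms of `(a + c)* (a + c)` have real value.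
  -- The cases `c = 1` and `c = I` suffice.
  have him (c : ℂ) : (star c * μ.1 a + c * μ.1 (star a)).im = 0 := by
    have e : star (a + c • 1) * (a + c • 1)
        = star a * a + (star c • a + c • star a) + star (c • (1 : A)) * (c • 1) := by
      simp only [star_add, star_smul, star_one, add_mul, mul_add, smul_add, mul_smul_comm,
        smul_mul_assoc, mul_one, one_mul]
      abel
    have h := (Complex.nonneg_iff.1 (μ.2.1 (a + c • 1))).2
    rw [e, map_add, map_add, map_add, map_smul, map_smul, smul_eq_mul, smul_eq_mul, Complex.add_im,
      Complex.add_im, ← (Complex.nonneg_iff.1 (μ.2.1 a)).2,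
      ← (Complex.nonneg_iff.1 (μ.2.1 (c • 1))).2] at h
    simpa using h.symm
  have h1 := him 1
  have h2 := him Complex.I
  simp at h1 h2
  apply Complex.ext
  · simp; linarith
  · simp; linarith

/-- A lower semicontinuous Lipschitz seminorm is, up to a factor of two, the Lipschitz constant
with respect to its Monge-Kantorovich metric. -/
theorem le_two_mul_of_lipschitz (hL : IsLipschitzSeminorm L) (hlsc : LowerSemicontinuous L)
    (b : A) {C : ℝ≥0∞}
    (h : ∀ μ ν : StateSpace A, ‖μ.1 b - ν.1 b‖ₑ ≤ C * mkDist L μ ν) :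
    L b ≤ 2 * C := by
  -- The self-adjoint case needs a positive real constant; replacing `C` by `C + η` covers `C = 0`.
  have hsa : ∀ x : A, IsSelfAdjoint x →
      (∀ μ ν : StateSpace A, ‖μ.1 x - ν.1 x‖ₑ ≤ C * mkDist L μ ν) → L x ≤ C := by
    intro x hx hxC
    refine ENNReal.le_of_forall_pos_le_add fun η hη hCtop => ?_
    have e : C + η = ENNReal.ofReal (C.toReal + η) := by
      rw [ENNReal.ofReal_add ENNReal.toReal_nonneg η.coe_nonneg, ENNReal.ofReal_toReal hCtop.ne,
        ENNReal.ofReal_coe_nnreal]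
    rw [e]
    refine le_ofReal_of_lipschitz hL hlsc hx
      (add_pos_of_nonneg_of_pos ENNReal.toReal_nonneg hη) fun μ ν => (hxC μ ν).trans ?_
    rw [← e]
    gcongr
    exact le_self_add
  have hre (μ : StateSpace A) : μ.1 (ℜ b : A) = ((μ.1 b).re : ℂ) := by
    rw [realPart_apply_coe, ← Complex.coe_smul, map_smul, map_add, state_star, smul_eq_mul]
    apply Complex.ext <;> (simp; try ring)
  have him (μ : StateSpace A) : μ.1 (ℑ b : A) = ((μ.1 b).im : ℂ) := by
    rw [imaginaryPart_apply_coe, ← Complex.coe_smul, map_smul, map_smul, map_sub, state_star,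
      smul_eq_mul, smul_eq_mul]
    apply Complex.ext <;> (simp; try ring)
  have h1 : L (ℜ b : A) ≤ C := by
    refine hsa _ (ℜ b).2 fun μ ν => le_trans ?_ (h μ ν)
    rw [hre, hre, ← Complex.ofReal_sub, ← Complex.sub_re, enorm_ofReal, enorm_le_iff_norm_le]
    exact Complex.abs_re_le_norm _
  have h2 : L (ℑ b : A) ≤ C := by
    refine hsa _ (ℑ b).2 fun μ ν => le_trans ?_ (h μ ν)
    rw [him, him, ← Complex.ofReal_sub, ← Complex.sub_im, enorm_ofReal, enorm_le_iff_norm_le]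
    exact Complex.abs_im_le_norm _
  calc L b = L ((ℜ b : A) + Complex.I • (ℑ b : A)) := by
        rw [realPart_add_I_smul_imaginaryPart]
    _ ≤ L (ℜ b : A) + L (Complex.I • (ℑ b : A)) := hL.add_le _ _
    _ ≤ C + C := by
        gcongr
        rw [hL.smul, ← ofReal_norm, Complex.norm_I, ENNReal.ofReal_one, one_mul]
        exact h2
    _ = 2 * C := (two_mul C).symm

end Rieffel

/-! ### Universal property of the inductive limit. -/

section Lift

variable {A : ℕ → Type u} [∀ n, CStarAlgebra (A n)] {φ : ∀ n, A n →⋆ₐ[ℂ] A (n + 1)}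
  {B : Type v} [CStarAlgebra B]

theorem continuous_starAlgHom {C : Type*} {D : Type*} [CStarAlgebra C] [CStarAlgebra D]
    (f : C →⋆ₐ[ℂ] D) : Continuous f :=
  AddMonoidHomClass.continuous_of_bound f 1 fun a => by
    simpa using NonUnitalStarAlgHom.norm_apply_le f a

theorem apply_connecting (ψ : ∀ n, A n →⋆ₐ[ℂ] B) (hψ : ∀ n, (ψ (n + 1)).comp (φ n) = ψ n)
    {n m : ℕ} (h : n ≤ m) (a : A n) : ψ m (connecting φ h a) = ψ n a := by
  induction m, h using Nat.le_induction with
  | base => rw [connecting_self]; rfl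
  | succ m h ih =>
    rw [connecting_succ φ h, ← ih, ← hψ m]; rfl

/-- The value of a compatible family of `*`-homomorphisms on an eventually coherent sequence. -/
noncomputable def PreLimit.lift (ψ : ∀ n, A n →⋆ₐ[ℂ] B) (x : PreLimit φ) : B :=
  limUnder atTop fun n => ψ n (x.coord n)

/-- Compatibility makes the sequence eventually constant. -/
theorem PreLimit.tendsto_lift (ψ : ∀ n, A n →⋆ₐ[ℂ] B)
    (hψ : ∀ n, (ψ (n + 1)).comp (φ n) = ψ n) (x : PreLimit φ) :
    Tendsto (fun n => ψ n (x.coord n)) atTop (𝓝 (PreLimit.lift ψ x)) := by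
  refine tendsto_nhds_limUnder ?_
  obtain ⟨N, hN⟩ := eventually_atTop.1 x.coord_succ
  refine ⟨ψ N (x.coord N), tendsto_const_nhds.congr' ?_⟩
  refine (eventually_ge_atTop N).mono fun m hm => ?_
  induction m, hm using Nat.le_induction with
  | base => rfl
  | succ m h ih =>
    refine ih.trans ?_
    beta_reduce
    rw [← hN m h, ← hψ m]; rfl

/-- The ring homomorphism on eventually coherent sequences induced by a compatible family. -/
noncomputable def PreLimit.liftHom (ψ : ∀ n, A n →⋆ₐ[ℂ] B)
    (hψ : ∀ n, (ψ (n + 1)).comp (φ n) = ψ n) : PreLimit φ →+* B where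
  toFun := PreLimit.lift ψ
  map_one' := tendsto_nhds_unique (PreLimit.tendsto_lift ψ hψ 1) (by simp)
  map_mul' x y := tendsto_nhds_unique (PreLimit.tendsto_lift ψ hψ (x * y)) (by
    simpa using (PreLimit.tendsto_lift ψ hψ x).mul (PreLimit.tendsto_lift ψ hψ y))
  map_zero' := tendsto_nhds_unique (PreLimit.tendsto_lift ψ hψ 0) (by simp)
  map_add' x y := tendsto_nhds_unique (PreLimit.tendsto_lift ψ hψ (x + y)) (by
    simpa using (PreLimit.tendsto_lift ψ hψ x).add (PreLimit.tendsto_lift ψ hψ y))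

theorem PreLimit.continuous_liftHom (ψ : ∀ n, A n →⋆ₐ[ℂ] B)
    (hψ : ∀ n, (ψ (n + 1)).comp (φ n) = ψ n) : Continuous (PreLimit.liftHom ψ hψ) :=
  AddMonoidHomClass.continuous_of_bound (PreLimit.liftHom ψ hψ) 1 fun x => by
    rw [one_mul]
    exact le_of_tendsto_of_tendsto' (PreLimit.tendsto_lift ψ hψ x).norm (PreLimit.tendsto_norm x)
      fun n => NonUnitalStarAlgHom.norm_apply_le (ψ n) _

namespace InductiveLimit

/-- The ring homomorphism on the inductive limit induced by a compatible family. -/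
noncomputable def liftRingHom (ψ : ∀ n, A n →⋆ₐ[ℂ] B)
    (hψ : ∀ n, (ψ (n + 1)).comp (φ n) = ψ n) : InductiveLimit φ →+* B :=
  UniformSpace.Completion.extensionHom (PreLimit.liftHom ψ hψ) (PreLimit.continuous_liftHom ψ hψ)

theorem continuous_liftRingHom (ψ : ∀ n, A n →⋆ₐ[ℂ] B)
    (hψ : ∀ n, (ψ (n + 1)).comp (φ n) = ψ n) : Continuous (liftRingHom ψ hψ) :=
  UniformSpace.Completion.continuous_extension

theorem liftRingHom_mk (ψ : ∀ n, A n →⋆ₐ[ℂ] B)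
    (hψ : ∀ n, (ψ (n + 1)).comp (φ n) = ψ n) (x : PreLimit φ) :
    liftRingHom ψ hψ (mk φ x) = PreLimit.lift ψ x :=
  UniformSpace.Completion.extensionHom_coe _ (PreLimit.continuous_liftHom ψ hψ) x

theorem map_eq_of_mk {f g : InductiveLimit φ → B} (hf : Continuous f) (hg : Continuous g)
    (h : ∀ x, f (mk φ x) = g (mk φ x)) (a : InductiveLimit φ) : f a = g a :=
  congrFun (denseRange_mk.equalizer hf hg (funext h)) a

/-- The universal property of the inductive limit: the unital `*`-homomorphism induced by a
compatible family. -/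
noncomputable def lift (ψ : ∀ n, A n →⋆ₐ[ℂ] B)
    (hψ : ∀ n, (ψ (n + 1)).comp (φ n) = ψ n) : InductiveLimit φ →⋆ₐ[ℂ] B where
  __ := liftRingHom ψ hψ
  commutes' c := by
    change liftRingHom ψ hψ (algebraMap ℂ _ c) = _
    rw [Algebra.algebraMap_eq_smul_one, ← mk_one, ← mk_smul, liftRingHom_mk]
    refine tendsto_nhds_unique (PreLimit.tendsto_lift ψ hψ _) ?_
    simp [Algebra.algebraMap_eq_smul_one]
  map_star' := by
    refine map_eq_of_mk (f := fun a => liftRingHom ψ hψ (star a))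
      (g := fun a => star (liftRingHom ψ hψ a))
      ((continuous_liftRingHom ψ hψ).comp continuous_star')
      (continuous_liftRingHom ψ hψ).star fun x => ?_
    simp only [← mk_star, liftRingHom_mk]
    refine tendsto_nhds_unique (PreLimit.tendsto_lift ψ hψ _) ?_
    simpa [map_star] using (PreLimit.tendsto_lift ψ hψ x).star

theorem lift_comp_of (ψ : ∀ n, A n →⋆ₐ[ℂ] B) (hψ : ∀ n, (ψ (n + 1)).comp (φ n) = ψ n) (n : ℕ) :
    (lift ψ hψ).comp (of φ n) = ψ n := by
  refine StarAlgHom.ext fun a => ?_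
  change liftRingHom ψ hψ (mk φ (PreLimit.tail φ n a)) = _
  rw [liftRingHom_mk]
  refine tendsto_nhds_unique (PreLimit.tendsto_lift ψ hψ _) (tendsto_const_nhds.congr' ?_)
  refine (eventually_ge_atTop n).mono fun m hm => ?_
  beta_reduce
  rw [PreLimit.tail_coord φ hm, apply_connecting ψ hψ hm]

theorem hom_ext {f g : InductiveLimit φ →⋆ₐ[ℂ] B}
    (h : ∀ n, f.comp (of φ n) = g.comp (of φ n)) : f = g := by
  refine DFunLike.coe_injective (Continuous.ext_on (dense_iUnion_range_of φ)
    (continuous_starAlgHom f) (continuous_starAlgHom g) fun a ha => ?_)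
  obtain ⟨n, a, rfl⟩ := Set.mem_iUnion.1 ha
  exact DFunLike.congr_fun (h n) a

end InductiveLimit
end Lift

/-! ### Lipschitz maps between state spaces. -/

section Distance

variable {A : Type u} [CStarAlgebra A] {B : Type v} [CStarAlgebra B]

theorem enorm_sub_le_mul_mkDist {L : B → ℝ≥0∞} (hL : IsLipschitzSeminorm L) (μ ν : StateSpace B)
    {c : ℝ} (hc : 0 < c) {b : B} (hb : L b ≤ ENNReal.ofReal c) :
    ‖μ.1 b - ν.1 b‖ₑ ≤ ENNReal.ofReal c * mkDist L μ ν := by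
  have h1 : L (c⁻¹ • b) ≤ 1 := by
    rw [hL.smul_real, Real.enorm_of_nonneg (inv_nonneg.2 hc.le)]
    calc _ ≤ ENNReal.ofReal c⁻¹ * ENNReal.ofReal c := by gcongr
      _ = 1 := by rw [← ENNReal.ofReal_mul (inv_nonneg.2 hc.le), inv_mul_cancel₀ hc.ne',
        ENNReal.ofReal_one]
  have h2 : ‖μ.1 (c⁻¹ • b) - ν.1 (c⁻¹ • b)‖ₑ ≤ mkDist L μ ν :=
    le_iSup₂_of_le (f := fun (a : B) (_ : L a ≤ 1) => ‖μ.1 a - ν.1 a‖ₑ) (c⁻¹ • b) h1 le_rfl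
  have h3 (κ : StateSpace B) : κ.1 b = (c : ℂ) * κ.1 (c⁻¹ • b) := by
    rw [← smul_eq_mul, ← map_smul, Complex.coe_smul, smul_inv_smul₀ hc.ne']
  rw [h3 μ, h3 ν, ← mul_sub, enorm_mul, enorm_ofReal, Real.enorm_of_nonneg hc.le]
  gcongr

/-- Pulling back states along a Lipschitz `*`-homomorphism is Lipschitz. -/
theorem mkDist_pullback_le {LA : A → ℝ≥0∞} {LB : B → ℝ≥0∞} (hB : IsLipschitzSeminorm LB)
    {f : A →⋆ₐ[ℂ] B} {c : ℝ} (hc : 0 < c) (hf : ∀ a, LB (f a) ≤ ENNReal.ofReal c * LA a)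
    (μ ν : StateSpace B) :
    mkDist LA (StateSpace.pullback f μ) (StateSpace.pullback f ν) ≤
      ENNReal.ofReal c * mkDist LB μ ν :=
  iSup₂_le fun a ha => enorm_sub_le_mul_mkDist hB μ ν hc
    ((hf a).trans (mul_le_of_le_one_right' ha))

end Distance

/-! ### Estimates for the metric and seminorm of the limit. -/

section LimitDistance

variable {A : ℕ → Type u} [∀ n, CStarAlgebra (A n)] (L : ∀ n, A n → ℝ≥0∞)
  (φ : ∀ n, A n →⋆ₐ[ℂ] A (n + 1))

theorem limitDist_le_of_restrictDist_le {μ ν : StateSpace (InductiveLimit φ)} {d : ℝ≥0∞}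
    (h : ∀ n, restrictDist L φ n μ ν ≤ d) : limitDist L φ μ ν ≤ d := by
  calc limitDist L φ μ ν ≤ ∑' n : ℕ, 2⁻¹ ^ (n + 1) * d := by
        refine ENNReal.tsum_le_tsum fun n => ?_
        gcongr
        -- This is `t / (1 + t) ≤ t`, valid also at `t = ∞`, where the quotient is `0` by
        -- convention.
        refine le_trans (ENNReal.div_le_of_le_mul ?_) (h n)
        rw [mul_add, mul_one]
        exact le_self_add
    _ = d := by
        rw [ENNReal.tsum_mul_right, ENNReal.tsum_geometric_add_one]
        simp [ENNReal.inv_mul_cancel]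

theorem limitDist_ne_top (μ ν : StateSpace (InductiveLimit φ)) : limitDist L φ μ ν ≠ ∞ := by
  refine ne_top_of_le_ne_top ENNReal.one_ne_top ?_
  calc limitDist L φ μ ν ≤ ∑' n : ℕ, 2⁻¹ ^ (n + 1) * 1 := by
        refine ENNReal.tsum_le_tsum fun n => ?_
        gcongr
        refine ENNReal.div_le_of_le_mul ?_
        rw [one_mul]
        exact le_add_self
    _ = 1 := by
        rw [ENNReal.tsum_mul_right, ENNReal.tsum_geometric_add_one]
        simp [ENNReal.inv_mul_cancel]

theorem enorm_sub_le_limitLipNorm_mul {a : InductiveLimit φ} (ha : limitLipNorm L φ a ≠ ∞)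
    (μ ν : StateSpace (InductiveLimit φ)) :
    ‖μ.1 a - ν.1 a‖ₑ ≤ limitLipNorm L φ a * limitDist L φ μ ν := by
  by_cases h : μ = ν
  · simp [h]
  -- Finiteness of `L(a)` handles a vanishing distance: a nonzero numerator would then give the
  -- quotient `∞`.
  · refine (ENNReal.div_le_iff_le_mul (.inr ha) (.inl (limitDist_ne_top L φ μ ν))).1 ?_
    exact le_iSup_of_le μ (le_iSup_of_le ν (le_iSup_of_le h le_rfl))

end LimitDistance

end QuantumMetric

theorem proposition4p1 {A : ℕ → Type*} [∀ n, CStarAlgebra (A n)]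
    (L : ∀ n, A n → ENNReal) (φ : ∀ n, A n →⋆ₐ[ℂ] A (n + 1))
    (hA : QuantumMetric.IsInductiveSequence L φ)
    {B : Type*} [CStarAlgebra B] (LB : B → ENNReal)
    (hB : QuantumMetric.IsLipNorm LB) (hlsc : LowerSemicontinuous LB)
    (lam : ℕ → ℝ) (hlam : ∀ n, 0 < lam n) (hbdd : BddAbove (Set.range lam))
    (ψ : ∀ n, A n →⋆ₐ[ℂ] B)
    (hcomm : ∀ n, (ψ (n + 1)).comp (φ n) = ψ n)
    (hψ : ∀ n a, LB (ψ n a) ≤ ENNReal.ofReal (lam n) * L n a) :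
    ∃ Ψ : QuantumMetric.InductiveLimit φ →⋆ₐ[ℂ] B,
      (∀ n, Ψ.comp (QuantumMetric.InductiveLimit.of φ n) = ψ n) ∧
      (∀ Ψ' : QuantumMetric.InductiveLimit φ →⋆ₐ[ℂ] B,
        (∀ n, Ψ'.comp (QuantumMetric.InductiveLimit.of φ n) = ψ n) → Ψ' = Ψ) ∧
      ∀ a : QuantumMetric.InductiveLimit φ,
        LB (Ψ a) ≤ ENNReal.ofReal (2 * ⨆ n, lam n) * QuantumMetric.limitLipNorm L φ a := by
  open QuantumMetric in
  have hof := InductiveLimit.lift_comp_of ψ hcomm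
  refine ⟨InductiveLimit.lift ψ hcomm, hof,
    fun Ψ' hΨ' => InductiveLimit.hom_ext fun n => (hΨ' n).trans (hof n).symm, fun a => ?_⟩
  set Ψ := InductiveLimit.lift ψ hcomm
  have hM : 0 < ⨆ n, lam n := (hlam 0).trans_le (le_ciSup hbdd 0)
  -- Positivity of the supremum excludes `0 * ∞ = 0` here.
  by_cases ha : limitLipNorm L φ a = ⊤
  · rw [ha, ENNReal.mul_top (by simpa using hM)]
    exact le_top
  rw [ENNReal.ofReal_mul zero_le_two, ENNReal.ofReal_ofNat, mul_assoc]
  refine le_two_mul_of_lipschitz hB.toIsLipschitzSeminorm hlsc (Ψ a) fun μ ν => ?_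
  have hdist : limitDist L φ (StateSpace.pullback Ψ μ) (StateSpace.pullback Ψ ν) ≤
      ENNReal.ofReal (⨆ n, lam n) * mkDist LB μ ν := by
    refine limitDist_le_of_restrictDist_le L φ fun n => ?_
    -- Restricting `μ ∘ Ψ` to the `n`-th algebra is pulling `μ` back along the composite, which
    -- equals `ψ n`.
    refine mkDist_pullback_le (f := Ψ.comp (InductiveLimit.of φ n)) hB.toIsLipschitzSeminorm hM
      (fun x => ?_) μ ν
    rw [hof n]
    refine (hψ n x).trans ?_
    gcongr
    exact le_ciSup hbdd n
  refine (enorm_sub_le_limitLipNorm_mul L φ ha (StateSpace.pullback Ψ μ)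
    (StateSpace.pullback Ψ ν)).trans ?_
  calc _ ≤ limitLipNorm L φ a * (ENNReal.ofReal (⨆ n, lam n) * mkDist LB μ ν) := by gcongr
    _ = _ := by ring
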